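/- Let $\Bbbk$ be an algebraically closed field, $H$ a group, and $A,B$ finite-dimensional (associative, unital) $\Bbbk$-algebras equipped with group homomorphisms $\phi:H\to\mathrm{Aut}_{\Bbbk\text{-alg}}(A)$, $h\mapsto\phi_h$, and $\omega:H\to\mathrm{Aut}_{\Bbbk\text{-alg}}(B)$. The $\phi$-extended centre $\mathcal Z^\phi(A)$ is the subalgebra of $A\otimes_{\Bbbk}\Bbbk H$ spanned by all $(a,h):=a\otimes h$, with $a\in A$, $h\in H$, such that $ab=\phi_h(b)\,a$ for all $b\in A$; similarly $\mathcal Z^\omega(B)\subset B\otimes_\Bbbk\Bbbk H$. Write $\mathcal D^b(A)$ for the bounded derived category of finite-dimensional left $A$-modules. For $h\in H$ let $\Phi_h$ be the exact functor on $A$-modules which keeps underlying spaces and maps and lets $a\in A$ act on $\Phi_hM$ as $\phi_{h^{-1}}(a)$ acts on $M$; denote by $\Phi_h$ also the induced functor on $\mathcal D^b(A)$, so that $\Phi_e=\mathrm{Id}$ and $\Phi_g\Phi_h=\Phi_{gh}$. Define $\Omega_h$ on $\mathcal D^b(B)$ from $\omega$ in the same way. Each $(a,h)\in\mathcal Z^\phi(A)$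 gives a natural transformation $\eta^{(a,h)}:\mathrm{Id}\Rightarrow\Phi_{h^{-1}}$ on $\mathcal D^b(A)$, by termwise multiplication by $a$; similarly for $B$. Let $F:\mathcal D^b(A)\xrightarrow{\sim}\mathcal D^b(B)$ be a $\Bbbk$-linear equivalence of triangulated categories which intertwines $\Phi$ and $\Omega$, i.e. which is equipped with natural transformations $\xi^h:F\circ\Phi_h\Rightarrow\Omega_h\circ F$ $(h\in H)$ such that $\xi^e=\mathrm{Id}_F$ and $\Omega_g(\xi^h)\circ\xi^g_{\Phi_h}=\xi^{gh}$ for all $g,h\in H$. Then $F$ induces a morphism of $\Bbbk$-algebras $$f:\mathcal Z^\phi(A)\to\mathcal Z^\omega(B),$$ in the following sense: for every $(a,h)\in\mathcal Z^\phi(A)$ one has $f(a,h)=(b,h)$ with $(b,h)\in\mathcal Z^\omega(B)$ such that the value at the left regular module ${}_BB$ of the composition $$\mathrm{Id}\cong FF^{-1}\xRightarrow{F(\eta^{(a,h)})}F\Phi_{h^{-1}}F^{-1}\xRightarrow{\ \xi^{h^{-1}}\ }\Omega_{h^{-1}}FF^{-1}\cong\Omega_{h^{-1}}$$ is equal to $\eta^{(b,h)}_{{}_BB}$.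 If $F$ is strong, i.e. if both $F({}_AA)$ and $F^{-1}({}_BB)$ are isomorphic in the derived category to complexes concentrated in one degree (the corresponding modules are then tilting modules), then $f$ is an isomorphism. -/

import Mathlib

open CategoryTheory Limits
open scoped TensorProduct

universe w w₁ w₂ v₁ v₂ v₃ u u₁ u₂ u₃ uk uH

noncomputable section

namespace ExtendedCentre

/-! ### The extended centre -/

section Centre

variable {k : Type uk} [Field k] {A : Type u} [Ring A] [Algebra k A] {H : Type uH} [Group H]

/-- The pair `(a, h)` satisfies `a b = φ_h(b) a` for all `b ∈ A`. -/
def IsTwistedCentral (φ : H →* (A ≃ₐ[k] A)) (a : A) (h : H) : Prop :=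
  ∀ b : A, a * b = φ h b * a

/-- The element `(a, h) = a ⊗ h` of `A ⊗ kH`. -/
def pair (k : Type uk) [Field k] {A : Type u} [Ring A] [Algebra k A] {H : Type uH} [Group H]
    (a : A) (h : H) : A ⊗[k] MonoidAlgebra k H :=
  a ⊗ₜ[k] MonoidAlgebra.of k H h

/-- The `φ`-extended centre: the subalgebra of `A ⊗ kH` spanned by all `(a, h)` with
`a b = φ_h(b) a` for all `b ∈ A`. -/
def extendedCentre (φ : H →* (A ≃ₐ[k] A)) : Subalgebra k (A ⊗[k] MonoidAlgebra k H) :=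
  (Submodule.span k {x | ∃ a h, IsTwistedCentral φ a h ∧ x = pair k a h}).toSubalgebra
    (Submodule.subset_span
      ⟨1, 1, fun b => by simp, by rw [pair, map_one, Algebra.TensorProduct.one_def]⟩)
    (fun x y hx hy => by
      have hxy := Submodule.mul_mem_mul hx hy
      rw [Submodule.span_mul_span] at hxy
      refine Submodule.span_mono ?_ hxy
      rintro _ ⟨_, ⟨a, h, ha, rfl⟩, _, ⟨b, g, hb, rfl⟩, rfl⟩
      refine ⟨a * b, h * g, fun c => ?_, ?_⟩
      · rw [mul_assoc, hb c, ← mul_assoc, ha, map_mul, AlgEquiv.mul_apply, mul_assoc]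
      · simp only [pair, Algebra.TensorProduct.tmul_mul_tmul, map_mul])

lemma pair_mem {φ : H →* (A ≃ₐ[k] A)} {a : A} {h : H} (ha : IsTwistedCentral φ a h) :
    pair k a h ∈ extendedCentre φ :=
  Submodule.subset_span ⟨a, h, ha, rfl⟩

end Centre

/-! ### Functors and natural transformations induced on bounded derived categories -/

section Derived

variable {C : Type u₁} [Category.{v₁} C] [Abelian C] [HasDerivedCategory.{w₁} C]
  {D : Type u₂} [Category.{v₂} D] [Abelian D] [HasDerivedCategory.{w₂} D]
  {E : Type u₃} [Category.{v₃} E] [Abelian E] [HasDerivedCategory.{w} E]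

/-- The natural transformation between derived categories induced by a natural transformation of
exact functors (applied termwise to complexes). -/
def derivedNatTrans {F G : C ⥤ D} [F.Additive] [PreservesFiniteLimits F]
    [PreservesFiniteColimits F] [G.Additive] [PreservesFiniteLimits G] [PreservesFiniteColimits G]
    (τ : F ⟶ G) : F.mapDerivedCategory ⟶ G.mapDerivedCategory :=
  Localization.liftNatTrans DerivedCategory.Q (HomologicalComplex.quasiIso C (ComplexShape.up ℤ))
    (F.mapHomologicalComplex _ ⋙ DerivedCategory.Q) (G.mapHomologicalComplex _ ⋙ DerivedCategory.Q)
    _ _ (Functor.whiskerRight (NatTrans.mapHomologicalComplex τ _) DerivedCategory.Q)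

variable (C) in
/-- The identity functor induces the identity functor on the derived category. -/
def derivedId : (𝟭 C).mapDerivedCategory ≅ 𝟭 (DerivedCategory C) :=
  Localization.liftNatIso DerivedCategory.Q (HomologicalComplex.quasiIso C (ComplexShape.up ℤ))
    ((𝟭 C).mapHomologicalComplex _ ⋙ DerivedCategory.Q) DerivedCategory.Q _ _
    (Functor.isoWhiskerRight (Functor.mapHomologicalComplexIdIso C _) DerivedCategory.Q ≪≫
      Functor.leftUnitor _)

/-- The composition of the functors induced by two exact functors is induced by the composition. -/
def derivedComp (F : C ⥤ D) (G : D ⥤ E) [F.Additive] [PreservesFiniteLimits F]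
    [PreservesFiniteColimits F] [G.Additive] [PreservesFiniteLimits G]
    [PreservesFiniteColimits G] :
    F.mapDerivedCategory ⋙ G.mapDerivedCategory ≅ (F ⋙ G).mapDerivedCategory :=
  Localization.liftNatIso DerivedCategory.Q (HomologicalComplex.quasiIso C (ComplexShape.up ℤ))
    ((F.mapHomologicalComplex _ ⋙ DerivedCategory.Q) ⋙ G.mapDerivedCategory)
    ((F ⋙ G).mapHomologicalComplex _ ⋙ DerivedCategory.Q) _ _
    (Functor.associator _ _ _ ≪≫
      Functor.isoWhiskerLeft _ G.mapDerivedCategoryFactors ≪≫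
      (Functor.associator _ _ _).symm ≪≫
      Functor.isoWhiskerRight (Functor.mapHomologicalComplexCompIso (Iso.refl (F ⋙ G)) _) DerivedCategory.Q)

/-- The functor on derived categories induced by an exact functor preserves bounded objects. -/
lemma mapDerivedCategory_bounded (F : C ⥤ D) [F.Additive] [PreservesFiniteLimits F]
    [PreservesFiniteColimits F] (X : DerivedCategory C)
    (hX : (DerivedCategory.TStructure.t (C := C)).bounded X) :
    (DerivedCategory.TStructure.t (C := D)).bounded (F.mapDerivedCategory.obj X) := by
  obtain ⟨⟨a, ⟨K, e, hK⟩⟩, ⟨b, ⟨L, e', hL⟩⟩⟩ := hX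
  refine ⟨⟨a, ⟨(F.mapHomologicalComplex _).obj K,
      F.mapDerivedCategory.mapIso e ≪≫ F.mapDerivedCategoryFactors.app K, ?_⟩⟩,
    ⟨b, ⟨(F.mapHomologicalComplex _).obj L,
      F.mapDerivedCategory.mapIso e' ≪≫ F.mapDerivedCategoryFactors.app L, ?_⟩⟩⟩
  · rw [CochainComplex.isStrictlyGE_iff] at hK ⊢
    exact fun i hi => F.map_isZero (hK i hi)
  · rw [CochainComplex.isStrictlyLE_iff] at hL ⊢
    exact fun i hi => F.map_isZero (hL i hi)

/-- The functor `F_• : D^b(C) ⥤ D^b(D)` induced by an exact functor `F : C ⥤ D`. -/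
def mapBounded (F : C ⥤ D) [F.Additive] [PreservesFiniteLimits F] [PreservesFiniteColimits F] :
    DerivedCategory.Bounded C ⥤ DerivedCategory.Bounded D :=
  ObjectProperty.lift _ (DerivedCategory.Bounded.ι ⋙ F.mapDerivedCategory)
    (fun X => mapDerivedCategory_bounded F X.obj X.property)

/-- The natural transformation `F_• ⟶ G_•` on bounded derived categories induced by `F ⟶ G`. -/
def boundedNatTrans {F G : C ⥤ D} [F.Additive] [PreservesFiniteLimits F]
    [PreservesFiniteColimits F] [G.Additive] [PreservesFiniteLimits G] [PreservesFiniteColimits G]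
    (τ : F ⟶ G) : mapBounded F ⟶ mapBounded G where
  app X := ObjectProperty.homMk ((derivedNatTrans τ).app X.obj)
  naturality _ _ f := ObjectProperty.hom_ext _ ((derivedNatTrans τ).naturality f.hom)

variable (C) in
/-- `(Id)_• ≅ Id` on the bounded derived category. -/
def boundedId : mapBounded (𝟭 C) ≅ 𝟭 (DerivedCategory.Bounded C) :=
  NatIso.ofComponents (fun X => ObjectProperty.isoMk _ ((derivedId C).app X.obj))
    (fun f => ObjectProperty.hom_ext _ ((derivedId C).hom.naturality f.hom))

/-- `G_• ∘ F_• ≅ (G ∘ F)_•` on bounded derived categories. -/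
def boundedComp (F : C ⥤ D) (G : D ⥤ E) [F.Additive] [PreservesFiniteLimits F]
    [PreservesFiniteColimits F] [G.Additive] [PreservesFiniteLimits G]
    [PreservesFiniteColimits G] : mapBounded F ⋙ mapBounded G ≅ mapBounded (F ⋙ G) :=
  NatIso.ofComponents (fun X => ObjectProperty.isoMk _ ((derivedComp F G).app X.obj))
    (fun f => ObjectProperty.hom_ext _ ((derivedComp F G).hom.naturality f.hom))

/-- An object `M` of `C` as a complex concentrated in degree `n`, in `D^b(C)`. -/
def single (n : ℤ) (M : C) : DerivedCategory.Bounded C :=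
  ⟨(DerivedCategory.singleFunctor C n).obj M, ⟨n, inferInstance⟩, ⟨n, inferInstance⟩⟩

end Derived

/-! ### Finite-dimensional modules and the categorical action -/

/-- The category `A-mod` of finite-dimensional left modules over a finite-dimensional `k`-algebra
`A`. As `A` is finite-dimensional, an `A`-module is finite-dimensional over `k` if and only if it
is finitely generated over `A`. -/
@[nolint unusedArguments]
def FinMod (k : Type uk) [Field k] (A : Type u) [Ring A] [Algebra k A] : Type (u + 1) :=
  FGModuleCat.{u} A

section Modules

variable (k : Type uk) [Field k] (A : Type u) [Ring A] [Algebra k A]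

instance : Category.{u} (FinMod k A) := inferInstanceAs (Category (FGModuleCat.{u} A))

variable [FiniteDimensional k A]

instance : Abelian (FinMod k A) :=
  haveI : IsNoetherianRing A := IsNoetherianRing.of_finite k A
  inferInstanceAs (Abelian (FGModuleCat.{u} A))

instance : Linear k (FinMod k A) := inferInstanceAs (Linear k (FGModuleCat.{u} A))

/-- The left regular module `_A A`. -/
def regular : FinMod k A := FGModuleCat.of A A

/-- The bounded derived category `D^b(A) = D^b(A-mod)`. -/
abbrev Db [HasDerivedCategory.{w} (FinMod k A)] : Type (u + 1) :=
  DerivedCategory.Bounded (FinMod k A)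

end Modules

section Twist

variable {k : Type uk} [Field k] {A : Type u} [Ring A] [Algebra k A] {H : Type uH} [Group H]
  (φ : H →* (A ≃ₐ[k] A))

/-- The algebra automorphism `φ_h` as a ring homomorphism. -/
abbrev actHom (h : H) : A →+* A := (φ h : A →ₐ[k] A)

/-- The functor `Φ_h` on `A-mod`: it keeps underlying spaces and maps, and lets `a` act on
`Φ_h M` as `φ_{h⁻¹}(a)` acts on `M`. -/
def twist (h : H) : FinMod k A ⥤ FinMod k A :=
  (ModuleCat.isFG A).lift
    ((ModuleCat.isFG A).ι ⋙ ModuleCat.restrictScalars.{u} (actHom φ h⁻¹)) (fun M => by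
      have hM : Module.Finite A M.obj := M.property
      obtain ⟨s, hs⟩ := hM.fg_top
      refine ⟨⟨s, ?_⟩⟩
      rw [eq_top_iff]
      intro x _
      have hx : (x : M.obj) ∈ Submodule.span A (s : Set M.obj) := by rw [hs]; trivial
      induction hx using Submodule.span_induction with
      | mem x hx => exact Submodule.subset_span hx
      | zero => exact Submodule.zero_mem _
      | add x y _ _ hx hy => exact Submodule.add_mem _ (hx trivial) (hy trivial)
      | smul a x _ hx =>
        have h1 := Submodule.smul_mem _ ((φ h⁻¹).symm a) (hx trivial)
        have h2 : actHom φ h⁻¹ ((φ h⁻¹).symm a) = a := (φ h⁻¹).apply_symm_apply a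
        rw [ModuleCat.restrictScalars.smul_def, h2] at h1
        exact h1)

/-- `Φ_e = Id` (the components are identity maps). -/
def twistOne : twist φ 1 ≅ 𝟭 (FinMod k A) :=
  NatIso.ofComponents (fun M => (ModuleCat.isFG A).isoMk
    (ModuleCat.restrictScalarsId'App (actHom φ (1 : H)⁻¹) (by ext; simp) M.obj))
    (fun _ => rfl)

/-- `Φ_g ∘ Φ_h = Φ_{gh}` (the components are identity maps). -/
def twistMul (g h : H) : twist φ h ⋙ twist φ g ≅ twist φ (g * h) :=
  NatIso.ofComponents (fun M => ((ModuleCat.isFG A).isoMk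
    (ModuleCat.restrictScalarsComp'App (actHom φ g⁻¹) (actHom φ h⁻¹) (actHom φ (g * h)⁻¹)
      (by ext; simp) M.obj)).symm)
    (fun _ => rfl)

/-- For `(a, h)` in the extended centre, the `A`-linear map `M → Φ_{h⁻¹} M`, `v ↦ a v`. -/
def multHom {a : A} {h : H} (ha : IsTwistedCentral φ a h) (M : ModuleCat.{u} A) :
    M ⟶ (ModuleCat.restrictScalars.{u} (actHom φ (h⁻¹)⁻¹)).obj M :=
  ModuleCat.ofHom (Y := (ModuleCat.restrictScalars.{u} (actHom φ (h⁻¹)⁻¹)).obj M)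
    { toFun := fun v => a • v
      map_add' := fun v w => smul_add a v w
      map_smul' := fun c v => by
        have h1 : actHom φ (h⁻¹)⁻¹ c = φ h c := by rw [inv_inv]; rfl
        change a • c • v = (actHom φ (h⁻¹)⁻¹ c • a • v : M)
        rw [h1, smul_smul, smul_smul, ha c] }

/-- For `(a, h)` in the extended centre, the natural transformation `Id ⟶ Φ_{h⁻¹}` on `A-mod`
given by `v ↦ a v`. -/
def multNat {a : A} {h : H} (ha : IsTwistedCentral φ a h) :
    𝟭 (FinMod k A) ⟶ twist φ h⁻¹ where
  app M := ObjectProperty.homMk (P := ModuleCat.isFG A) (multHom φ ha M.obj)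
  naturality _ _ f := ObjectProperty.hom_ext (ModuleCat.isFG A)
    (ModuleCat.hom_ext (LinearMap.ext fun v => (map_smul f.hom.hom a v).symm))

variable [FiniteDimensional k A]

instance (h : H) : (twist φ h).IsEquivalence := by
  let e : FinMod k A ≌ FinMod k A := CategoryTheory.Equivalence.mk (twist φ h) (twist φ h⁻¹)
    ((twistOne φ).symm ≪≫ eqToIso (by rw [inv_mul_cancel]) ≪≫ (twistMul φ h⁻¹ h).symm)
    (twistMul φ h h⁻¹ ≪≫ eqToIso (by rw [mul_inv_cancel]) ≪≫ twistOne φ)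
  exact e.isEquivalence_functor

instance (h : H) : (twist φ h).Additive where
  map_add := rfl

variable [HasDerivedCategory.{w} (FinMod k A)]

/-- The functor `Φ_h` on `D^b(A)`. -/
def dbTwist (h : H) : Db k A ⥤ Db k A := mapBounded (twist φ h)

/-- `Φ_e = Id` on `D^b(A)`. -/
def dbTwistOne : dbTwist φ 1 ⟶ 𝟭 (Db k A) :=
  boundedNatTrans (twistOne φ).hom ≫ (boundedId _).hom

/-- `Φ_g ∘ Φ_h = Φ_{gh}` on `D^b(A)`. -/
def dbTwistMul (g h : H) : dbTwist φ h ⋙ dbTwist φ g ⟶ dbTwist φ (g * h) :=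
  (boundedComp _ _).hom ≫ boundedNatTrans (twistMul φ g h).hom

/-- For `(a, h)` in the extended centre, the natural transformation `Id ⟶ Φ_{h⁻¹}` on `D^b(A)`
given by termwise multiplication by `a`. -/
def dbMult {a : A} {h : H} (ha : IsTwistedCentral φ a h) : 𝟭 (Db k A) ⟶ dbTwist φ h⁻¹ :=
  (boundedId _).inv ≫ boundedNatTrans (multNat φ ha)

end Twist

/-! ### Intertwining derived equivalences and the induced morphism -/

section Equivalences

variable {k : Type uk} [Field k] {H : Type uH} [Group H]
  {A : Type u₁} [Ring A] [Algebra k A] [FiniteDimensional k A]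
  {B : Type u₂} [Ring B] [Algebra k B] [FiniteDimensional k B]
  [HasDerivedCategory.{w₁} (FinMod k A)] [HasDerivedCategory.{w₂} (FinMod k B)]

/-- The data by which a functor `K : D^b(A) ⥤ D^b(B)` intertwines the categorical `H`-actions `Φ`
and `Ω`: natural transformations `ξ^h : K ∘ Φ_h ⟶ Ω_h ∘ K` with `ξ^e = Id_K` and
`Ω_g(ξ^h) ∘ ξ^g_{Φ_h} = ξ^{gh}`, where the identifications `Φ_e = Id`, `Φ_g ∘ Φ_h = Φ_{gh}`
(and the same for `Ω`) are written out. -/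
structure Intertwining (φ : H →* (A ≃ₐ[k] A)) (ω : H →* (B ≃ₐ[k] B)) (K : Db k A ⥤ Db k B) where
  /-- The natural transformations `ξ^h`. -/
  ξ (h : H) : dbTwist φ h ⋙ K ⟶ K ⋙ dbTwist ω h
  ξ_one (X : Db k A) :
    (ξ 1).app X ≫ (dbTwistOne ω).app (K.obj X) = K.map ((dbTwistOne φ).app X)
  ξ_mul (g h : H) (X : Db k A) :
    (ξ g).app ((dbTwist φ h).obj X) ≫ (dbTwist ω g).map ((ξ h).app X) ≫
        (dbTwistMul ω g h).app (K.obj X) =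
      K.map ((dbTwistMul φ g h).app X) ≫ (ξ (g * h)).app X

/-- The transport of a natural transformation `η : Id ⟶ Φ_h` along an intertwining equivalence
`F`: the composition `Id ≅ F F⁻¹ ⟶ F Φ_h F⁻¹ ⟶ Ω_h F F⁻¹ ≅ Ω_h`. -/
def transport {φ : H →* (A ≃ₐ[k] A)} {ω : H →* (B ≃ₐ[k] B)} (F : Db k A ≌ Db k B)
    (I : Intertwining φ ω F.functor) {h : H} (η : 𝟭 (Db k A) ⟶ dbTwist φ h) :
    𝟭 (Db k B) ⟶ dbTwist ω h where
  app Y := F.counitInv.app Y ≫ F.functor.map (η.app (F.inverse.obj Y)) ≫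
    (I.ξ h).app (F.inverse.obj Y) ≫ (dbTwist ω h).map (F.counit.app Y)
  naturality Y Y' f := by
    have h1 := F.counitInv.naturality f
    have h2 := η.naturality (F.inverse.map f)
    have h3 := (I.ξ h).naturality (F.inverse.map f)
    have h4 := F.counit.naturality f
    dsimp at h1 h2 h3 h4 ⊢
    rw [reassoc_of% h1, ← Functor.map_comp_assoc, h2, Functor.map_comp_assoc, reassoc_of% h3]
    simp only [Category.assoc, ← Functor.map_comp, h4]

/-- The algebra morphism `f : Z^φ(A) → Z^ω(B)` is the one induced by the intertwining
equivalence `F`: for `(a, h) ∈ Z^φ(A)` one has `f(a, h) = (b, h)`, where multiplication by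
`b` on the regular module `_B B` (in degree `0`) is the value at `_B B` of the transport along `F`
of the natural transformation `Id ⟶ Φ_{h⁻¹}` of multiplication by `a`. -/
def IsInduced {φ : H →* (A ≃ₐ[k] A)} {ω : H →* (B ≃ₐ[k] B)} (F : Db k A ≌ Db k B)
    (I : Intertwining φ ω F.functor) (f : extendedCentre φ →ₐ[k] extendedCentre ω) : Prop :=
  ∀ (a : A) (h : H) (ha : IsTwistedCentral φ a h),
    ∃ (b : B) (hb : IsTwistedCentral ω b h),
      f ⟨pair k a h, pair_mem ha⟩ = ⟨pair k b h, pair_mem hb⟩ ∧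
      (transport F I (dbMult φ ha)).app (single 0 (regular k B)) =
        (dbMult ω hb).app (single 0 (regular k B))

/-- The equivalence `F` is strong: both `F(_A A)` and `F⁻¹(_B B)` are isomorphic in the derived
category to complexes concentrated in one degree. -/
def IsStrong (F : Db k A ≌ Db k B) : Prop :=
  (∃ (n : ℤ) (M : FinMod k B),
    Nonempty (F.functor.obj (single 0 (regular k A)) ≅ single n M)) ∧
  (∃ (n : ℤ) (M : FinMod k A),
    Nonempty (F.inverse.obj (single 0 (regular k B)) ≅ single n M))

end Equivalences

end ExtendedCentre

end

/-! The extended centre is the direct sum, over `h`, of the spaces of twisted central elements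
(`sumEquiv`). So `f` can be built one degree at a time (`inducedMap`), and its multiplicativity only
needs checking on pairs `(a, g)`, `(b, h)`.

The element `b` comes from a Yoneda argument. On the regular module, a natural transformation `Id ⟶
Φ_l` is an `A`-linear map `A → Φ_l A` that commutes with all right multiplications. It is therefore
left multiplication by the image of `1`, and that image is twisted central of degree `l⁻¹`
(`exists_eq_multTo`). Modules embed fully faithfully into `D^b` as complexes in a fixed degree, so
this applies to the transported transformation at `_B B` and determines `b` uniquely. Composing the
transformations of `(b, h)` and `(a, g)` gives that of `(a b, g h)`, and the cocycle identities for
`ξ` say that transport respects such composites (`transport_comp`) and the unit (`transport_one`).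

Suppose now that `F` is strong, with `F(A) ≅ M` in degree `m` and `F⁻¹(B)` a module `T` in one
degree. If `f(a, h) = 0`, the transport of `η = η^{(a,h)}` vanishes at `B` in degree `0`, so `η`
vanishes at `T` in one degree. Being termwise multiplication, `η` then vanishes at `T` in every
degree. Hence the transport vanishes at `B` in degree `m`, then at every module in degree `m`, in
particular at `M ≅ F(A)`. So `η` vanishes at `A`, and `a = 0` (`inducedMap_injective`). The same
argument for `F⁻¹` gives an injection the other way between finite-dimensional spaces, so each
component of `f` is bijective. -/

noncomputable section

namespace ExtendedCentre

/-! ### Termwise formulas for transformations induced on derived categories -/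

section Derived

variable {C : Type u₁} [Category.{v₁} C] [Abelian C] [HasDerivedCategory.{w₁} C]
  {D : Type u₂} [Category.{v₂} D] [Abelian D] [HasDerivedCategory.{w₂} D]
  {E : Type u₃} [Category.{v₃} E] [Abelian E] [HasDerivedCategory.{w} E]

/-- The functor induced by an exact functor is computed termwise on complexes. -/
def mapQIso (F : C ⥤ D) [F.Additive] [PreservesFiniteLimits F]
    [PreservesFiniteColimits F] (K : CochainComplex C ℤ) :
    F.mapDerivedCategory.obj (DerivedCategory.Q.obj K) ≅
      DerivedCategory.Q.obj ((F.mapHomologicalComplex (ComplexShape.up ℤ)).obj K) :=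
  F.mapDerivedCategoryFactors.app K

lemma mapQIso_hom_naturality (F : C ⥤ D) [F.Additive] [PreservesFiniteLimits F]
    [PreservesFiniteColimits F] {K L : CochainComplex C ℤ} (f : K ⟶ L) :
    F.mapDerivedCategory.map (DerivedCategory.Q.map f) ≫ (mapQIso F L).hom =
      (mapQIso F K).hom ≫ DerivedCategory.Q.map ((F.mapHomologicalComplex _).map f) :=
  F.mapDerivedCategoryFactors.hom.naturality f

lemma derivedNatTrans_app_Q {F G : C ⥤ D} [F.Additive] [PreservesFiniteLimits F]
    [PreservesFiniteColimits F] [G.Additive] [PreservesFiniteLimits G] [PreservesFiniteColimits G]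
    (τ : F ⟶ G) (K : CochainComplex C ℤ) :
    (derivedNatTrans τ).app (DerivedCategory.Q.obj K) =
      (mapQIso F K).hom ≫ DerivedCategory.Q.map ((NatTrans.mapHomologicalComplex τ _).app K) ≫
          (mapQIso G K).inv :=
  Localization.liftNatTrans_app _ _ _ _ _ _ _ K

/-- The identity functor acts on complexes as the identity. -/
def idComplexIso (K : CochainComplex C ℤ) :
    ((𝟭 C).mapHomologicalComplex (ComplexShape.up ℤ)).obj K ≅ K :=
  (Functor.mapHomologicalComplexIdIso C _).app K

lemma derivedId_hom_app_Q (K : CochainComplex C ℤ) :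
    (derivedId C).hom.app (DerivedCategory.Q.obj K) =
      (mapQIso (𝟭 C) K).hom ≫ DerivedCategory.Q.map (idComplexIso K).hom := by
  refine (Localization.liftNatTrans_app _ _ _ _ _ _ _ K).trans ?_
  dsimp [Localization.Lifting.iso]
  simp only [Category.comp_id]
  rfl

lemma derivedId_inv_app_Q (K : CochainComplex C ℤ) :
    (derivedId C).inv.app (DerivedCategory.Q.obj K) =
      DerivedCategory.Q.map (idComplexIso K).inv ≫ (mapQIso (𝟭 C) K).inv := by
  have h := (derivedId C).hom_inv_id_app (DerivedCategory.Q.obj K)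
  rw [derivedId_hom_app_Q] at h
  exact (Iso.inv_ext (f := mapQIso (𝟭 C) K ≪≫ DerivedCategory.Q.mapIso (idComplexIso K)) h).symm

/-- The composition of exact functors is computed termwise on complexes. -/
def compComplexIso (F : C ⥤ D) (G : D ⥤ E) [F.Additive] [G.Additive] (K : CochainComplex C ℤ) :
    (G.mapHomologicalComplex (ComplexShape.up ℤ)).obj
        ((F.mapHomologicalComplex (ComplexShape.up ℤ)).obj K) ≅
      ((F ⋙ G).mapHomologicalComplex (ComplexShape.up ℤ)).obj K :=
  (Functor.mapHomologicalComplexCompIso (Iso.refl (F ⋙ G)) _).app K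

lemma derivedComp_hom_app_Q (F : C ⥤ D) (G : D ⥤ E) [F.Additive] [PreservesFiniteLimits F]
    [PreservesFiniteColimits F] [G.Additive] [PreservesFiniteLimits G]
    [PreservesFiniteColimits G] (K : CochainComplex C ℤ) :
    (derivedComp F G).hom.app (DerivedCategory.Q.obj K) =
      G.mapDerivedCategory.map (mapQIso F K).hom ≫
        (mapQIso G ((F.mapHomologicalComplex _).obj K)).hom ≫
          DerivedCategory.Q.map (compComplexIso F G K).hom ≫ (mapQIso (F ⋙ G) K).inv := by
  refine (Localization.liftNatTrans_app _ _ _ _ _ _ _ K).trans ?_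
  dsimp [Localization.Lifting.iso]
  simp
  rfl

/-- The termwise morphism of complexes given by a natural transformation from the identity. -/
def unitComplex {F : C ⥤ C} [F.Additive] (σ : 𝟭 C ⟶ F) (K : CochainComplex C ℤ) :
    K ⟶ (F.mapHomologicalComplex _).obj K where
  f i := σ.app (K.X i)
  comm' i j _ := (σ.naturality (K.d i j)).symm

/-- The natural transformation on derived categories induced by a natural transformation from the
identity to an exact functor. -/
def derivedUnit {F : C ⥤ C} [F.Additive] [PreservesFiniteLimits F]
    [PreservesFiniteColimits F] (σ : 𝟭 C ⟶ F) : 𝟭 (DerivedCategory C) ⟶ F.mapDerivedCategory :=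
  (derivedId C).inv ≫ derivedNatTrans σ

lemma derivedUnit_app_Q {F : C ⥤ C} [F.Additive] [PreservesFiniteLimits F]
    [PreservesFiniteColimits F] (σ : 𝟭 C ⟶ F) (K : CochainComplex C ℤ) :
    (derivedUnit σ).app (DerivedCategory.Q.obj K) =
      DerivedCategory.Q.map (unitComplex σ K) ≫ (mapQIso F K).inv := by
  have h : unitComplex σ K =
      (idComplexIso K).inv ≫ (NatTrans.mapHomologicalComplex σ _).app K := by
    ext i
    exact (Category.id_comp _).symm
  rw [h, derivedUnit, NatTrans.comp_app, derivedId_inv_app_Q, derivedNatTrans_app_Q,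
    Category.assoc, Functor.map_comp, Category.assoc, Iso.inv_hom_id_assoc]

lemma derivedUnit_add {F : C ⥤ C} [F.Additive] [PreservesFiniteLimits F]
    [PreservesFiniteColimits F] (σ τ : 𝟭 C ⟶ F) :
    derivedUnit (σ + τ) = derivedUnit σ + derivedUnit τ := by
  refine Localization.natTrans_ext DerivedCategory.Q
    (HomologicalComplex.quasiIso C (ComplexShape.up ℤ)) fun K => ?_
  have : unitComplex (σ + τ) K = unitComplex σ K + unitComplex τ K := by
    ext; rfl
  simp only [derivedUnit_app_Q, NatTrans.app_add, this, Functor.map_add, Preadditive.add_comp]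

lemma derivedUnit_smul {R : Type*} [CommRing R] [Linear R C]
    {F : C ⥤ C} [F.Additive] [PreservesFiniteLimits F]
    [PreservesFiniteColimits F] (r : R) (σ : 𝟭 C ⟶ F) :
    derivedUnit (r • σ) = r • derivedUnit σ := by
  refine Localization.natTrans_ext DerivedCategory.Q
    (HomologicalComplex.quasiIso C (ComplexShape.up ℤ)) fun K => ?_
  have : unitComplex (r • σ) K = r • unitComplex σ K := by
    ext; rfl
  simp only [derivedUnit_app_Q, NatTrans.app_smul, this, Functor.map_smul, Linear.smul_comp]

/-- Transformations between functors on a localization agree once they agree on the objects `Q K`.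
There each factor is a termwise map of complexes conjugated by `mapQIso`, the conjugations cancel,
and what remains is `hρ` in each degree. -/
lemma derivedUnit_comp {F G K : C ⥤ C} [F.Additive] [PreservesFiniteLimits F]
    [PreservesFiniteColimits F] [G.Additive] [PreservesFiniteLimits G]
    [PreservesFiniteColimits G] [K.Additive] [PreservesFiniteLimits K]
    [PreservesFiniteColimits K] (σ : 𝟭 C ⟶ F) (τ : 𝟭 C ⟶ G) (μ : G ⋙ F ⟶ K) (ρ : 𝟭 C ⟶ K)
    (hρ : ∀ M, σ.app M ≫ F.map (τ.app M) ≫ μ.app M = ρ.app M) (X : DerivedCategory C) :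
    (derivedUnit σ).app X ≫ F.mapDerivedCategory.map ((derivedUnit τ).app X) ≫
      (derivedComp G F).hom.app X ≫ (derivedNatTrans μ).app X = (derivedUnit ρ).app X := by
  suffices h : derivedUnit σ ≫ Functor.whiskerRight (derivedUnit τ) F.mapDerivedCategory ≫
      (derivedComp G F).hom ≫ derivedNatTrans μ = derivedUnit ρ from congr_app h X
  refine Localization.natTrans_ext DerivedCategory.Q
    (HomologicalComplex.quasiIso C (ComplexShape.up ℤ)) fun L => ?_
  have h2 : unitComplex ρ L = unitComplex σ L ≫ (F.mapHomologicalComplex _).map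
        (unitComplex τ L) ≫ (compComplexIso G F L).hom ≫
        (NatTrans.mapHomologicalComplex μ _).app L := by
    ext i
    -- The components of `compComplexIso` are identities, so the degree `i` part is `hρ` with an
    -- identity inserted.
    have h := hρ (L.X i)
    rw [← Category.id_comp (μ.app (L.X i))] at h
    exact h.symm
  rw [NatTrans.comp_app, NatTrans.comp_app, NatTrans.comp_app, Functor.whiskerRight_app,
    derivedUnit_app_Q, derivedUnit_app_Q, derivedUnit_app_Q, derivedNatTrans_app_Q,
    derivedComp_hom_app_Q, h2]
  have h3 := mapQIso_hom_naturality F (unitComplex τ L)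
  simp only [Functor.map_comp, Category.assoc, Iso.inv_hom_id_assoc, Iso.map_inv_hom_id_assoc,
    reassoc_of% h3]

lemma derivedUnit_comp_derivedNatTrans {F : C ⥤ C} [F.Additive] [PreservesFiniteLimits F]
    [PreservesFiniteColimits F] (σ : 𝟭 C ⟶ F) (ε : F ⟶ 𝟭 C) (h : ∀ M, σ.app M ≫ ε.app M = 𝟙 M) :
    derivedUnit σ ≫ derivedNatTrans ε ≫ (derivedId C).hom = 𝟙 _ := by
  refine Localization.natTrans_ext DerivedCategory.Q
    (HomologicalComplex.quasiIso C (ComplexShape.up ℤ)) fun L => ?_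
  have h2 : unitComplex σ L ≫ (NatTrans.mapHomologicalComplex ε _).app L ≫ (idComplexIso L).hom =
      𝟙 L := by
    ext i
    have h := h (L.X i)
    rw [← Category.comp_id (ε.app (L.X i))] at h
    exact h
  rw [NatTrans.comp_app, NatTrans.comp_app, derivedUnit_app_Q, derivedNatTrans_app_Q,
    derivedId_hom_app_Q]
  simp only [Category.assoc, Iso.inv_hom_id_assoc, ← Functor.map_comp]
  rw [h2]
  exact DerivedCategory.Q.map_id L

/-- An exact functor takes an object in degree `n` to an object in degree `n`, on complexes. -/
def mapSingleComplexIso (F : C ⥤ D) [F.Additive] (n : ℤ) (M : C) :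
    (F.mapHomologicalComplex (ComplexShape.up ℤ)).obj ((CochainComplex.singleFunctor C n).obj M) ≅
      (CochainComplex.singleFunctor D n).obj (F.obj M) :=
  (HomologicalComplex.singleMapHomologicalComplex F (ComplexShape.up ℤ) n).app M

/-- The functor induced by an exact functor takes an object in degree `n` to an object in
degree `n`. -/
def mapSingleIso (F : C ⥤ D) [F.Additive] [PreservesFiniteLimits F]
    [PreservesFiniteColimits F] (n : ℤ) (M : C) :
    F.mapDerivedCategory.obj ((DerivedCategory.singleFunctor C n).obj M) ≅
      (DerivedCategory.singleFunctor D n).obj (F.obj M) :=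
  mapQIso F ((CochainComplex.singleFunctor C n).obj M) ≪≫
    DerivedCategory.Q.mapIso (mapSingleComplexIso F n M)

lemma mapSingleIso_hom_naturality (F : C ⥤ D) [F.Additive] [PreservesFiniteLimits F]
    [PreservesFiniteColimits F] (n : ℤ) {M N : C} (f : M ⟶ N) :
    F.mapDerivedCategory.map ((DerivedCategory.singleFunctor C n).map f) ≫
        (mapSingleIso F n N).hom =
      (mapSingleIso F n M).hom ≫ (DerivedCategory.singleFunctor D n).map (F.map f) := by
  change F.mapDerivedCategory.map
      (DerivedCategory.Q.map ((CochainComplex.singleFunctor C n).map f)) ≫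
        (mapQIso F _).hom ≫ DerivedCategory.Q.map (mapSingleComplexIso F n N).hom =
      ((mapQIso F _).hom ≫ DerivedCategory.Q.map (mapSingleComplexIso F n M).hom) ≫
        DerivedCategory.Q.map ((CochainComplex.singleFunctor D n).map (F.map f))
  have h := mapQIso_hom_naturality F ((CochainComplex.singleFunctor C n).map f)
  rw [reassoc_of% h, Category.assoc, ← Functor.map_comp, ← Functor.map_comp]
  congr 2
  exact (HomologicalComplex.singleMapHomologicalComplex F (ComplexShape.up ℤ) n).hom.naturality f

lemma derivedUnit_app_single {F : C ⥤ C} [F.Additive] [PreservesFiniteLimits F]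
    [PreservesFiniteColimits F] (σ : 𝟭 C ⟶ F) (n : ℤ) (M : C) :
    (derivedUnit σ).app ((DerivedCategory.singleFunctor C n).obj M) ≫ (mapSingleIso F n M).hom =
        (DerivedCategory.singleFunctor C n).map (σ.app M) := by
  have h2 : unitComplex σ ((CochainComplex.singleFunctor C n).obj M) ≫
      (mapSingleComplexIso F n M).hom = (CochainComplex.singleFunctor C n).map (σ.app M) := by
    refine HomologicalComplex.from_single_hom_ext ?_
    -- The degree `n` term of the single complex is only isomorphic to `M`; naturality of `σ` along
    -- that isomorphism bridges the gap.
    have h := σ.naturality (HomologicalComplex.singleObjXSelf (ComplexShape.up ℤ) n M).hom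
    have h' := HomologicalComplex.single_map_f_self (c := ComplexShape.up ℤ) n (σ.app M)
    change σ.app (((HomologicalComplex.single C (ComplexShape.up ℤ) n).obj M).X n) ≫
      ((HomologicalComplex.singleMapHomologicalComplex F (ComplexShape.up ℤ) n).hom.app M).f n =
      ((HomologicalComplex.single C (ComplexShape.up ℤ) n).map (σ.app M)).f n
    rw [HomologicalComplex.singleMapHomologicalComplex_hom_app_self]
    refine Eq.trans ?_ h'.symm
    exact (Category.assoc _ _ _).symm.trans ((h.symm =≫ _).trans (Category.assoc _ _ _))
  change (derivedUnit σ).app (DerivedCategory.Q.obj _) ≫ (mapQIso F _).hom ≫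
    DerivedCategory.Q.map (mapSingleComplexIso F n M).hom =
      DerivedCategory.Q.map ((CochainComplex.singleFunctor C n).map (σ.app M))
  rw [derivedUnit_app_Q, ← h2, Category.assoc, Iso.inv_hom_id_assoc, ← Functor.map_comp]

end Derived

/-! ### Bounded derived categories and restriction to modules in one degree -/

section Bounded

variable {C : Type u₁} [Category.{v₁} C] [Abelian C] [HasDerivedCategory.{w₁} C]

/-- The natural transformation on bounded derived categories induced by a natural transformation
from the identity to an exact functor. -/
def boundedUnit {F : C ⥤ C} [F.Additive] [PreservesFiniteLimits F]
    [PreservesFiniteColimits F] (σ : 𝟭 C ⟶ F) :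
    𝟭 (DerivedCategory.Bounded C) ⟶ mapBounded F :=
  (boundedId C).inv ≫ boundedNatTrans σ

lemma boundedUnit_add {F : C ⥤ C} [F.Additive] [PreservesFiniteLimits F]
    [PreservesFiniteColimits F] (σ τ : 𝟭 C ⟶ F) (X : DerivedCategory.Bounded C) :
    (boundedUnit (σ + τ)).app X = (boundedUnit σ).app X + (boundedUnit τ).app X :=
  ObjectProperty.hom_ext _ (congr_app (derivedUnit_add σ τ) X.obj)

lemma boundedUnit_smul {R : Type*} [CommRing R] [Linear R C]
    {F : C ⥤ C} [F.Additive] [PreservesFiniteLimits F]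
    [PreservesFiniteColimits F] (r : R) (σ : 𝟭 C ⟶ F) (X : DerivedCategory.Bounded C) :
    (boundedUnit (r • σ)).app X = r • (boundedUnit σ).app X :=
  ObjectProperty.hom_ext _ (congr_app (derivedUnit_smul r σ) X.obj)

lemma boundedUnit_comp {F G K : C ⥤ C} [F.Additive] [PreservesFiniteLimits F]
    [PreservesFiniteColimits F] [G.Additive] [PreservesFiniteLimits G]
    [PreservesFiniteColimits G] [K.Additive] [PreservesFiniteLimits K]
    [PreservesFiniteColimits K] (σ : 𝟭 C ⟶ F) (τ : 𝟭 C ⟶ G) (μ : G ⋙ F ⟶ K) (ρ : 𝟭 C ⟶ K)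
    (hρ : ∀ M, σ.app M ≫ F.map (τ.app M) ≫ μ.app M = ρ.app M) (X : DerivedCategory.Bounded C) :
    (boundedUnit σ).app X ≫ (mapBounded F).map ((boundedUnit τ).app X) ≫
      ((boundedComp G F).hom ≫ boundedNatTrans μ).app X = (boundedUnit ρ).app X :=
  ObjectProperty.hom_ext _ (derivedUnit_comp σ τ μ ρ hρ X.obj)

lemma boundedUnit_comp_boundedNatTrans {F : C ⥤ C} [F.Additive] [PreservesFiniteLimits F]
    [PreservesFiniteColimits F] (σ : 𝟭 C ⟶ F) (ε : F ⟶ 𝟭 C) (h : ∀ M, σ.app M ≫ ε.app M = 𝟙 M)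
    (X : DerivedCategory.Bounded C) :
    (boundedUnit σ).app X ≫ (boundedNatTrans ε ≫ (boundedId C).hom).app X = 𝟙 X :=
  ObjectProperty.hom_ext _ (congr_app (derivedUnit_comp_derivedNatTrans σ ε h) X.obj)

/-- The functor which sends an object to the corresponding complex concentrated in degree `n`. -/
def singleB (n : ℤ) : C ⥤ DerivedCategory.Bounded C where
  obj M := single n M
  map f := ObjectProperty.homMk ((DerivedCategory.singleFunctor C n).map f)
  map_id M := ObjectProperty.hom_ext _ ((DerivedCategory.singleFunctor C n).map_id M)
  map_comp f g := ObjectProperty.hom_ext _ ((DerivedCategory.singleFunctor C n).map_comp f g)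

instance (n : ℤ) : (singleB n : C ⥤ DerivedCategory.Bounded C).Full where
  map_surjective f := by
    obtain ⟨g, hg⟩ := (DerivedCategory.singleFunctor C n).map_surjective f.hom
    exact ⟨g, ObjectProperty.hom_ext _ hg⟩

instance (n : ℤ) : (singleB n : C ⥤ DerivedCategory.Bounded C).Faithful where
  map_injective h :=
    (DerivedCategory.singleFunctor C n).map_injective (congrArg (fun f => f.hom) h)

/-- A shift of a complex concentrated in one degree is concentrated in one degree. -/
def singleShiftIso (n a m : ℤ) (h : a + m = n) (M : C) : (single n M)⟦a⟧ ≅ single m M :=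
  DerivedCategory.Bounded.ι.preimageIso
    ((DerivedCategory.Bounded.ι.commShiftIso a).app (single n M) ≪≫
      ((DerivedCategory.singleFunctors C).shiftIso a m n h).app M)

/-- The functor induced by an exact functor takes an object in degree `n` to an object in
degree `n`, in the bounded derived category. -/
def mapBoundedSingleIso (F : C ⥤ C) [F.Additive] [PreservesFiniteLimits F]
    [PreservesFiniteColimits F] (n : ℤ) (M : C) :
    (mapBounded F).obj ((singleB n).obj M) ≅ (singleB n).obj (F.obj M) :=
  ObjectProperty.isoMk _ (mapSingleIso F n M)

lemma mapBoundedSingleIso_hom_naturality (F : C ⥤ C) [F.Additive] [PreservesFiniteLimits F]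
    [PreservesFiniteColimits F] (n : ℤ) {M N : C} (f : M ⟶ N) :
    (mapBounded F).map ((singleB n).map f) ≫ (mapBoundedSingleIso F n N).hom =
      (mapBoundedSingleIso F n M).hom ≫ (singleB n).map (F.map f) :=
  ObjectProperty.hom_ext _ (mapSingleIso_hom_naturality F n f)

/-- The restriction to objects in degree `n` of a natural transformation on the bounded derived
category from the identity to the functor induced by an exact functor. -/
def heart {F : C ⥤ C} [F.Additive] [PreservesFiniteLimits F] [PreservesFiniteColimits F]
    (θ : 𝟭 (DerivedCategory.Bounded C) ⟶ mapBounded F) (n : ℤ) : 𝟭 C ⟶ F where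
  app M := (singleB n).preimage
    (θ.app ((singleB n).obj M) ≫ (mapBoundedSingleIso F n M).hom)
  naturality M N f := (singleB n).map_injective (by
    have h := θ.naturality ((singleB n).map f)
    simp only [Functor.id_map] at h
    simp only [Functor.id_map, Functor.map_comp, Functor.map_preimage, Category.assoc]
    rw [reassoc_of% h, mapBoundedSingleIso_hom_naturality])

lemma heart_app_eq_iff {F : C ⥤ C} [F.Additive] [PreservesFiniteLimits F]
    [PreservesFiniteColimits F] (θ θ' : 𝟭 (DerivedCategory.Bounded C) ⟶ mapBounded F) (n : ℤ)
    (M : C) :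
    (heart θ n).app M = (heart θ' n).app M ↔ θ.app (single n M) = θ'.app (single n M) := by
  rw [← (singleB n).map_injective.eq_iff]
  simp only [heart, Functor.map_preimage]
  exact cancel_mono _

/-- The answer does not depend on `n`: for a termwise transformation, unlike for an arbitrary one,
the restrictions to different degrees coincide. -/
lemma heart_boundedUnit {F : C ⥤ C} [F.Additive] [PreservesFiniteLimits F]
    [PreservesFiniteColimits F] (σ : 𝟭 C ⟶ F) (n : ℤ) : heart (boundedUnit σ) n = σ := by
  ext M
  apply (singleB n).map_injective
  simp only [heart, Functor.map_preimage]
  exact ObjectProperty.hom_ext _ (derivedUnit_app_single σ n M)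

instance (n : ℤ) : (singleB n : C ⥤ DerivedCategory.Bounded C).Additive where
  map_add := ObjectProperty.hom_ext _ ((DerivedCategory.singleFunctor C n).map_add)

lemma heart_app_eq_zero_iff {F : C ⥤ C} [F.Additive] [PreservesFiniteLimits F]
    [PreservesFiniteColimits F] (θ : 𝟭 (DerivedCategory.Bounded C) ⟶ mapBounded F) (n : ℤ)
    (M : C) : (heart θ n).app M = 0 ↔ θ.app (single n M) = 0 := by
  rw [← (singleB n).map_eq_zero_iff]
  simp only [heart, Functor.map_preimage]
  exact ⟨fun h => (cancel_mono (mapBoundedSingleIso F n M).hom).1 (h.trans zero_comp.symm),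
    fun h => (h =≫ _).trans zero_comp⟩

end Bounded

/-! ### Twisted central elements as natural transformations of modules -/

section Mult

variable {k : Type uk} [Field k] {A : Type u} [Ring A] [Algebra k A] {H : Type uH} [Group H]
  (φ : H →* (A ≃ₐ[k] A))

/-- Multiplication by `a`, as a natural transformation from the identity to `Φ_l`. -/
def multTo {a : A} {l : H} (ha : IsTwistedCentral φ a l⁻¹) : 𝟭 (FinMod k A) ⟶ twist φ l where
  app M := ObjectProperty.homMk (P := ModuleCat.isFG A) (ModuleCat.ofHom
    (Y := (ModuleCat.restrictScalars.{u} (actHom φ l⁻¹)).obj M.obj)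
    { toFun := fun v => a • v
      map_add' := fun v w => smul_add a v w
      map_smul' := fun c v => by
        change a • c • v = (φ l⁻¹ c • a • v : M.obj)
        rw [smul_smul, smul_smul, ha c] })
  naturality _ _ f := ObjectProperty.hom_ext (ModuleCat.isFG A)
    (ModuleCat.hom_ext (LinearMap.ext fun v => (map_smul f.hom.hom a v).symm))

/-- The composite is `v ↦ b v ↦ a (b v)`: the right factor acts first, hence the order `m * l` of
the indices. -/
lemma multTo_comp {a b : A} {l m : H} (ha : IsTwistedCentral φ a l⁻¹)
    (hb : IsTwistedCentral φ b m⁻¹) (hab : IsTwistedCentral φ (a * b) (m * l)⁻¹)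
    (M : FinMod k A) :
    (multTo φ hb).app M ≫ (twist φ m).map ((multTo φ ha).app M) ≫ (twistMul φ m l).hom.app M =
      (multTo φ hab).app M :=
  ObjectProperty.hom_ext (ModuleCat.isFG A)
    (ModuleCat.hom_ext (LinearMap.ext fun v => (mul_smul a b (v : M.obj)).symm))

lemma multTo_one (h1 : IsTwistedCentral φ (1 : A) (1 : H)⁻¹) (M : FinMod k A) :
    (multTo φ h1).app M ≫ (twistOne φ).hom.app M = 𝟙 M :=
  ObjectProperty.hom_ext (ModuleCat.isFG A)
    (ModuleCat.hom_ext (LinearMap.ext fun v => one_smul A (v : M.obj)))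

/-- The morphism from the regular module to `M` with value `x` at `1`. -/
def ofElement (M : FinMod k A) (x : M.obj) : regular k A ⟶ M :=
  ObjectProperty.homMk (P := ModuleCat.isFG A)
    (ModuleCat.ofHom (LinearMap.toSpanSingleton A M.obj x))

/-- With `g` the component at the regular module, linearity gives `g c = φ_{l⁻¹}(c) g 1`, and
naturality along right multiplication by `c` gives `g c = g 1 * c`. Comparing the two is exactly
twisted centrality of `g 1`. -/
lemma exists_eq_multTo {l : H} (σ : 𝟭 (FinMod k A) ⟶ twist φ l) :
    ∃ (a : A) (ha : IsTwistedCentral φ a l⁻¹),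
      σ.app (regular k A) = (multTo φ ha).app (regular k A) := by
  let g : A → A := fun x => (σ.app (regular k A)).hom.hom x
  have h1 (c : A) : g c = φ l⁻¹ c * g 1 := by
    have := (σ.app (regular k A)).hom.hom.map_smul c (1 : A)
    have h : g (c * 1) = φ l⁻¹ c * g 1 := this
    rwa [mul_one] at h
  have h2 (c : A) : g c = g 1 * c := by
    have h : g ((1 : A) • c) = g 1 * c :=
      congrArg (fun f : regular k A ⟶ (twist φ l).obj (regular k A) => f.hom.hom (1 : A))
        (σ.naturality (ofElement (regular k A) c))
    rwa [one_smul] at h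
  refine ⟨g 1, fun c => (h2 c).symm.trans (h1 c), ObjectProperty.hom_ext (ModuleCat.isFG A)
    (ModuleCat.hom_ext (LinearMap.ext fun v => h2 v))⟩

lemma multTo_app_regular_injective {a b : A} {l : H} (ha : IsTwistedCentral φ a l⁻¹)
    (hb : IsTwistedCentral φ b l⁻¹)
    (h : (multTo φ ha).app (regular k A) = (multTo φ hb).app (regular k A)) : a = b := by
  have h' : a * 1 = b * 1 :=
    congrArg (fun f : regular k A ⟶ (twist φ l).obj (regular k A) => f.hom.hom (1 : A)) h
  simpa using h'

variable [FiniteDimensional k A]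

lemma multTo_add {a b : A} {l : H} (ha : IsTwistedCentral φ a l⁻¹)
    (hb : IsTwistedCentral φ b l⁻¹) (hab : IsTwistedCentral φ (a + b) l⁻¹) :
    multTo φ hab = multTo φ ha + multTo φ hb :=
  NatTrans.ext (funext fun M => ObjectProperty.hom_ext (ModuleCat.isFG A)
    (ModuleCat.hom_ext (LinearMap.ext fun v => add_smul a b (v : M.obj))))

lemma multTo_smul {a : A} {l : H} (c : k) (ha : IsTwistedCentral φ a l⁻¹)
    (hca : IsTwistedCentral φ (c • a) l⁻¹) :
    multTo φ hca = c • multTo φ ha :=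
  NatTrans.ext (funext fun M => ObjectProperty.hom_ext (ModuleCat.isFG A)
    (ModuleCat.hom_ext (LinearMap.ext fun v => by
      -- Scalars act on the twisted module through `φ_{l⁻¹}`, which fixes them since it is a
      -- `k`-algebra map.
      change (c • a) • (v : M.obj) = φ l⁻¹ (algebraMap k A c) • a • (v : M.obj)
      rw [AlgEquiv.commutes, smul_smul, Algebra.smul_def])))

/-- A natural transformation to `Φ_l` which vanishes on the regular module vanishes. -/
lemma eq_zero_of_app_regular {l : H} (σ : 𝟭 (FinMod k A) ⟶ twist φ l)
    (h : σ.app (regular k A) = 0) : σ = 0 := by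
  ext M
  refine ObjectProperty.hom_ext (ModuleCat.isFG A)
    (ModuleCat.hom_ext (LinearMap.ext fun (v : M.obj) => ?_))
  have h1 := σ.naturality (ofElement M v)
  rw [h, zero_comp] at h1
  have h2 := congrArg (fun f : regular k A ⟶ (twist φ l).obj M => f.hom.hom (1 : A)) h1
  have h3 : (σ.app M).hom.hom ((1 : A) • v) = 0 := h2
  rwa [one_smul] at h3

end Mult

/-! ### Isomorphisms of exact functors on bounded derived categories -/

section BoundedIso

variable {C : Type u₁} [Category.{v₁} C] [Abelian C] [HasDerivedCategory.{w₁} C]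

lemma derivedNatTrans_id (F : C ⥤ C) [F.Additive] [PreservesFiniteLimits F]
    [PreservesFiniteColimits F] : derivedNatTrans (𝟙 F) = 𝟙 _ := by
  refine Localization.natTrans_ext DerivedCategory.Q
    (HomologicalComplex.quasiIso C (ComplexShape.up ℤ)) fun K => ?_
  have h : (NatTrans.mapHomologicalComplex (𝟙 F) (ComplexShape.up ℤ)).app K = 𝟙 _ := by
    ext; rfl
  rw [derivedNatTrans_app_Q, h]
  simp

lemma derivedNatTrans_comp {F G K : C ⥤ C} [F.Additive] [PreservesFiniteLimits F]
    [PreservesFiniteColimits F] [G.Additive] [PreservesFiniteLimits G]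
    [PreservesFiniteColimits G] [K.Additive] [PreservesFiniteLimits K]
    [PreservesFiniteColimits K] (σ : F ⟶ G) (τ : G ⟶ K) :
    derivedNatTrans (σ ≫ τ) = derivedNatTrans σ ≫ derivedNatTrans τ := by
  refine Localization.natTrans_ext DerivedCategory.Q
    (HomologicalComplex.quasiIso C (ComplexShape.up ℤ)) fun L => ?_
  have h : (NatTrans.mapHomologicalComplex (σ ≫ τ) (ComplexShape.up ℤ)).app L =
      (NatTrans.mapHomologicalComplex σ (ComplexShape.up ℤ)).app L ≫
        (NatTrans.mapHomologicalComplex τ (ComplexShape.up ℤ)).app L := by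
    ext; rfl
  rw [NatTrans.comp_app, derivedNatTrans_app_Q, derivedNatTrans_app_Q, derivedNatTrans_app_Q, h]
  simp

/-- The isomorphism on bounded derived categories induced by an isomorphism of exact functors. -/
def boundedNatIso {F G : C ⥤ C} [F.Additive] [PreservesFiniteLimits F]
    [PreservesFiniteColimits F] [G.Additive] [PreservesFiniteLimits G]
    [PreservesFiniteColimits G] (e : F ≅ G) : mapBounded F ≅ mapBounded G where
  hom := boundedNatTrans e.hom
  inv := boundedNatTrans e.inv
  hom_inv_id := by
    ext X
    have h := derivedNatTrans_comp e.hom e.inv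
    rw [e.hom_inv_id, derivedNatTrans_id] at h
    exact (congr_app h X.obj).symm
  inv_hom_id := by
    ext X
    have h := derivedNatTrans_comp e.inv e.hom
    rw [e.inv_hom_id, derivedNatTrans_id] at h
    exact (congr_app h X.obj).symm

end BoundedIso

/-! ### Twists and multiplications on the bounded derived category -/

section Twist

variable {k : Type uk} [Field k] {A : Type u} [Ring A] [Algebra k A] {H : Type uH} [Group H]
  (φ : H →* (A ≃ₐ[k] A)) [FiniteDimensional k A] [HasDerivedCategory.{w} (FinMod k A)]

instance : IsIso (dbTwistOne φ) :=
  inferInstanceAs (IsIso ((boundedNatIso (twistOne φ)).hom ≫ (boundedId _).hom))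

instance (g h : H) : IsIso (dbTwistMul φ g h) :=
  inferInstanceAs (IsIso ((boundedComp _ _).hom ≫ (boundedNatIso (twistMul φ g h)).hom))

instance (h : H) : (dbTwist φ h).IsEquivalence := by
  let e : Db k A ≌ Db k A := CategoryTheory.Equivalence.mk (dbTwist φ h) (dbTwist φ h⁻¹)
    ((asIso (dbTwistOne φ)).symm ≪≫ eqToIso (by rw [inv_mul_cancel]) ≪≫
      (asIso (dbTwistMul φ h⁻¹ h)).symm)
    (asIso (dbTwistMul φ h h⁻¹) ≪≫ eqToIso (by rw [mul_inv_cancel]) ≪≫ asIso (dbTwistOne φ))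
  exact e.isEquivalence_functor

/-- Multiplication by `a`, as a natural transformation from the identity to `Φ_l` on `D^b(A)`. -/
def dbMultTo {a : A} {l : H} (ha : IsTwistedCentral φ a l⁻¹) : 𝟭 (Db k A) ⟶ dbTwist φ l :=
  boundedUnit (multTo φ ha)

lemma dbMultTo_comp {a b : A} {l m : H} (ha : IsTwistedCentral φ a l⁻¹)
    (hb : IsTwistedCentral φ b m⁻¹) (hab : IsTwistedCentral φ (a * b) (m * l)⁻¹) (X : Db k A) :
    (dbMultTo φ hb).app X ≫ (dbTwist φ m).map ((dbMultTo φ ha).app X) ≫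
      (dbTwistMul φ m l).app X = (dbMultTo φ hab).app X :=
  boundedUnit_comp _ _ _ _ (multTo_comp φ ha hb hab) X

lemma dbMultTo_one (h1 : IsTwistedCentral φ (1 : A) (1 : H)⁻¹) (X : Db k A) :
    (dbMultTo φ h1).app X ≫ (dbTwistOne φ).app X = 𝟙 X :=
  boundedUnit_comp_boundedNatTrans _ _ (multTo_one φ h1) X

lemma dbMultTo_add {a b : A} {l : H} (ha : IsTwistedCentral φ a l⁻¹)
    (hb : IsTwistedCentral φ b l⁻¹) (hab : IsTwistedCentral φ (a + b) l⁻¹) (X : Db k A) :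
    (dbMultTo φ hab).app X = (dbMultTo φ ha).app X + (dbMultTo φ hb).app X := by
  rw [dbMultTo, multTo_add φ ha hb hab]
  exact boundedUnit_add _ _ X

lemma dbMultTo_smul {a : A} {l : H} (c : k) (ha : IsTwistedCentral φ a l⁻¹)
    (hca : IsTwistedCentral φ (c • a) l⁻¹) (X : Db k A) :
    (dbMultTo φ hca).app X = c • (dbMultTo φ ha).app X := by
  rw [dbMultTo, multTo_smul φ c ha hca]
  exact boundedUnit_smul _ _ X

lemma dbMultTo_app_regular_injective {a b : A} {l : H} (ha : IsTwistedCentral φ a l⁻¹)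
    (hb : IsTwistedCentral φ b l⁻¹) (h : (dbMultTo φ ha).app (single 0 (regular k A)) =
      (dbMultTo φ hb).app (single 0 (regular k A))) : a = b := by
  have h' := (heart_app_eq_iff _ _ _ _).2 h
  rw [dbMultTo, dbMultTo, heart_boundedUnit, heart_boundedUnit] at h'
  exact multTo_app_regular_injective φ ha hb h'

lemma exists_eq_dbMultTo {l : H} (θ : 𝟭 (Db k A) ⟶ dbTwist φ l) :
    ∃ (a : A) (ha : IsTwistedCentral φ a l⁻¹),
      θ.app (single 0 (regular k A)) = (dbMultTo φ ha).app (single 0 (regular k A)) := by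
  obtain ⟨a, ha, h⟩ := exists_eq_multTo φ (heart θ 0)
  refine ⟨a, ha, (heart_app_eq_iff _ _ _ _).1 ?_⟩
  rw [dbMultTo, heart_boundedUnit, h]

/-- A natural transformation to `Φ_l` which vanishes on the regular module in degree `n` vanishes
on all modules in degree `n`. -/
lemma app_single_eq_zero {l : H} (θ : 𝟭 (Db k A) ⟶ dbTwist φ l) (n : ℤ)
    (h : θ.app (single n (regular k A)) = 0) (M : FinMod k A) : θ.app (single n M) = 0 := by
  have h' := (heart_app_eq_zero_iff θ n _).2 h
  refine (heart_app_eq_zero_iff θ n M).1 ?_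
  rw [eq_zero_of_app_regular φ _ h']
  rfl

/-- This is the step of the injectivity argument that changes degree. A general transformation, such
as a transported one, is not known to commute with shifts; here termwise multiplication is used. -/
lemma dbMultTo_app_single_eq_zero_iff {a : A} {l : H} (ha : IsTwistedCentral φ a l⁻¹) (m n : ℤ)
    (M : FinMod k A) :
    (dbMultTo φ ha).app (single m M) = 0 ↔ (dbMultTo φ ha).app (single n M) = 0 := by
  have hM (n : ℤ) := heart_app_eq_zero_iff (boundedUnit (multTo φ ha)) n M
  simp only [heart_boundedUnit] at hM
  exact (hM m).symm.trans (hM n)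

lemma eq_zero_of_dbMultTo {a : A} {l : H} (ha : IsTwistedCentral φ a l⁻¹)
    (h : (dbMultTo φ ha).app (single 0 (regular k A)) = 0) : a = 0 := by
  have h0 : IsTwistedCentral φ (0 : A) l⁻¹ := fun b => by simp
  refine dbMultTo_app_regular_injective φ ha h0 (h.trans ?_)
  have h1 := dbMultTo_smul φ 0 h0 (by simpa using h0) (single 0 (regular k A))
  simpa using h1.symm

end Twist

/-! ### Transport along an intertwining equivalence -/

section Transport

variable {k : Type uk} [Field k] {H : Type uH} [Group H]
  {A : Type u₁} [Ring A] [Algebra k A] [FiniteDimensional k A]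
  {B : Type u₂} [Ring B] [Algebra k B] [FiniteDimensional k B]
  [HasDerivedCategory.{w₁} (FinMod k A)] [HasDerivedCategory.{w₂} (FinMod k B)]
  {φ : H →* (A ≃ₐ[k] A)} {ω : H →* (B ≃ₐ[k] B)}

/-- Invertibility follows from the cocycle identities. `ξ^e` is invertible, so `ξ^{g⁻¹}_{Φ_g X}`
followed by `Ω_{g⁻¹}(ξ^g_X)` is too. As `Ω_{g⁻¹}` is an equivalence, every `ξ^g_X` is a split
epimorphism; the first factor is also a monomorphism, hence invertible, and therefore so is the
second. -/
instance isIso_ξ_app {K : Db k A ⥤ Db k B} (I : Intertwining φ ω K) (h : H) (X : Db k A) :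
    IsIso ((I.ξ h).app X) := by
  have h1 (X : Db k A) : IsIso ((I.ξ 1).app X) := by
    have : IsIso ((I.ξ 1).app X ≫ (dbTwistOne ω).app (K.obj X)) := by
      rw [I.ξ_one]; infer_instance
    exact IsIso.of_isIso_comp_right _ ((dbTwistOne ω).app (K.obj X))
  have h2 (l : H) (hl : l = 1) (X : Db k A) : IsIso ((I.ξ l).app X) := by subst hl; exact h1 X
  have h3 (g : H) (X : Db k A) : IsIso ((I.ξ g⁻¹).app ((dbTwist φ g).obj X) ≫
      (dbTwist ω g⁻¹).map ((I.ξ g).app X)) := by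
    have := h2 (g⁻¹ * g) (inv_mul_cancel g) X
    have : IsIso (((I.ξ g⁻¹).app ((dbTwist φ g).obj X) ≫
      (dbTwist ω g⁻¹).map ((I.ξ g).app X)) ≫ (dbTwistMul ω g⁻¹ g).app (K.obj X)) := by
      rw [Category.assoc, I.ξ_mul]; infer_instance
    exact IsIso.of_isIso_comp_right _ ((dbTwistMul ω g⁻¹ g).app (K.obj X))
  have h4 (g : H) (X : Db k A) : IsSplitEpi ((I.ξ g).app X) := by
    have := h3 g X
    rw [← (dbTwist ω g⁻¹).isSplitEpi_iff]
    exact ⟨⟨⟨inv ((I.ξ g⁻¹).app ((dbTwist φ g).obj X) ≫ (dbTwist ω g⁻¹).map ((I.ξ g).app X)) ≫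
      (I.ξ g⁻¹).app ((dbTwist φ g).obj X), by simp⟩⟩⟩
  have := h3 h X
  have h5 : IsIso ((I.ξ h⁻¹).app ((dbTwist φ h).obj X)) := by
    have := h4 h⁻¹ ((dbTwist φ h).obj X)
    have : Mono ((I.ξ h⁻¹).app ((dbTwist φ h).obj X)) :=
      mono_of_mono _ ((dbTwist ω h⁻¹).map ((I.ξ h).app X))
    exact isIso_of_mono_of_isSplitEpi _
  have h6 : IsIso ((dbTwist ω h⁻¹).map ((I.ξ h).app X)) :=
    IsIso.of_isIso_comp_left ((I.ξ h⁻¹).app ((dbTwist φ h).obj X)) _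
  exact isIso_of_reflects_iso _ (dbTwist ω h⁻¹)

/-- The transport of a natural transformation `η : Id ⟶ Φ_l` along an equivalence `F` with a
natural transformation `ξ : F ∘ Φ_l ⟶ Ω_l ∘ F`. -/
def transportAlong (F : Db k A ≌ Db k B) {l : H}
    (ξ : dbTwist φ l ⋙ F.functor ⟶ F.functor ⋙ dbTwist ω l) (η : 𝟭 (Db k A) ⟶ dbTwist φ l) :
    𝟭 (Db k B) ⟶ dbTwist ω l :=
  F.counitInv ≫ Functor.whiskerLeft F.inverse (Functor.whiskerRight η F.functor ≫ ξ) ≫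
    Functor.whiskerRight F.counit (dbTwist ω l)

lemma transportAlong_app (F : Db k A ≌ Db k B) {l : H}
    (ξ : dbTwist φ l ⋙ F.functor ⟶ F.functor ⋙ dbTwist ω l) (η : 𝟭 (Db k A) ⟶ dbTwist φ l)
    (Y : Db k B) :
    (transportAlong F ξ η).app Y = F.counitInv.app Y ≫ F.functor.map (η.app (F.inverse.obj Y)) ≫
      ξ.app (F.inverse.obj Y) ≫ (dbTwist ω l).map (F.counit.app Y) := by
  simp [transportAlong]

/-- `transportAlong` uses a single `ξ^l` without cocycle identities, so it also serves for the
inverse equivalence, where only one such transformation is constructed. -/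
lemma transport_app (F : Db k A ≌ Db k B) (I : Intertwining φ ω F.functor) {l : H}
    (η : 𝟭 (Db k A) ⟶ dbTwist φ l) (Y : Db k B) :
    (transport F I η).app Y = (transportAlong F (I.ξ l) η).app Y := by
  rw [transportAlong_app]; rfl

lemma transport_comp (F : Db k A ≌ Db k B) (I : Intertwining φ ω F.functor) {g h : H}
    (η : 𝟭 (Db k A) ⟶ dbTwist φ g) (η' : 𝟭 (Db k A) ⟶ dbTwist φ h)
    (η'' : 𝟭 (Db k A) ⟶ dbTwist φ (g * h))
    (H : ∀ X, η.app X ≫ (dbTwist φ g).map (η'.app X) ≫ (dbTwistMul φ g h).app X = η''.app X)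
    (Y : Db k B) :
    (transport F I η).app Y ≫ (dbTwist ω g).map ((transport F I η').app Y) ≫
      (dbTwistMul ω g h).app Y = (transport F I η'').app Y := by
  have h1 := (dbTwistMul ω g h).naturality (F.counit.app Y)
  have h2 := (I.ξ g).naturality (η'.app (F.inverse.obj Y))
  have h3 := I.ξ_mul g h (F.inverse.obj Y)
  dsimp at h1 h2
  dsimp only [transport]
  rw [← H]
  simp only [Functor.map_comp, Category.assoc]
  -- Naturality brings the counit and its inverse together so that they cancel; `ξ_mul` then merges
  -- `ξ^g` and `ξ^h` into `ξ^{gh}`.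
  rw [h1, ← reassoc_of% h3, reassoc_of% h2,
    ← Functor.map_comp_assoc (dbTwist ω g) (F.counit.app Y)]
  simp

lemma transport_one (F : Db k A ≌ Db k B) (I : Intertwining φ ω F.functor)
    (η : 𝟭 (Db k A) ⟶ dbTwist φ 1) (h : ∀ X, η.app X ≫ (dbTwistOne φ).app X = 𝟙 X)
    (Y : Db k B) : (transport F I η).app Y ≫ (dbTwistOne ω).app Y = 𝟙 Y := by
  have h1 := (dbTwistOne ω).naturality (F.counit.app Y)
  have h2 := I.ξ_one (F.inverse.obj Y)
  dsimp at h1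
  dsimp only [transport]
  simp only [Category.assoc]
  rw [h1, reassoc_of% h2, ← Functor.map_comp_assoc, h]
  simp

/-- All factors other than `F(η)` are invertible, and `F` is faithful. -/
lemma transportAlong_app_eq_zero_iff (F : Db k A ≌ Db k B) [F.functor.Additive] {l : H}
    (ξ : dbTwist φ l ⋙ F.functor ≅ F.functor ⋙ dbTwist ω l) (η : 𝟭 (Db k A) ⟶ dbTwist φ l)
    (Y : Db k B) :
    (transportAlong F ξ.hom η).app Y = 0 ↔ η.app (F.inverse.obj Y) = 0 := by
  rw [transportAlong_app, ← F.functor.map_eq_zero_iff]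
  refine ⟨fun h => ?_, fun h => by simp [h]⟩
  rwa [← Category.assoc, Preadditive.IsIso.comp_right_eq_zero,
    Preadditive.IsIso.comp_left_eq_zero] at h

end Transport

/-! ### The extended centre as a graded algebra -/

section Graded

variable {k : Type uk} [Field k] {A : Type u} [Ring A] [Algebra k A] {H : Type uH} [Group H]
  (φ : H →* (A ≃ₐ[k] A))

/-- The subspace of all `a` with `a b = φ_h(b) a` for all `b`. -/
def twistedCentral (h : H) : Submodule k A where
  carrier := {a | IsTwistedCentral φ a h}
  zero_mem' b := by simp
  add_mem' ha hb c := by rw [add_mul, mul_add, ha c, hb c]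
  smul_mem' c a ha b := by rw [smul_mul_assoc, mul_smul_comm, ha b]

/-- The coefficient at `h` of an element of `A ⊗ kH`. -/
def coeffAt (h : H) : A ⊗[k] MonoidAlgebra k H →ₗ[k] A :=
  TensorProduct.lift ((LinearMap.lsmul k A).flip.compl₂
    (Finsupp.lapply h ∘ₗ (MonoidAlgebra.coeffLinearEquiv k).toLinearMap))

open Classical in
lemma coeffAt_pair (a : A) (g h : H) :
    coeffAt (k := k) h (pair k a g) = if g = h then a else 0 := by
  simp [coeffAt, pair, MonoidAlgebra.of, MonoidAlgebra.coeffLinearEquiv, Finsupp.single_apply]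

open Classical in
/-- The extended centre is the direct sum of the spaces of twisted central elements. -/
def sumMap : (Π₀ h, twistedCentral φ h) →ₗ[k] extendedCentre φ :=
  DFinsupp.lsum ℕ fun h =>
    { toFun a := ⟨pair k a.1 h, pair_mem a.2⟩
      map_add' _ _ := Subtype.ext (TensorProduct.add_tmul _ _ _)
      map_smul' _ _ := Subtype.ext (TensorProduct.smul_tmul' _ _ _).symm }

open Classical in
lemma sumMap_single (h : H) (a : twistedCentral φ h) :
    sumMap φ (DFinsupp.single h a) = ⟨pair k a.1 h, pair_mem a.2⟩ := by
  simp [sumMap]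

lemma coeffAt_sumMap (x : Π₀ h, twistedCentral φ h) (h : H) :
    coeffAt h (sumMap φ x : A ⊗[k] MonoidAlgebra k H) = x h := by
  classical
  induction x using DFinsupp.induction with
  | h0 => simp
  | ha g b f _ _ ih =>
    rw [map_add, Subalgebra.coe_add, map_add, ih, sumMap_single, coeffAt_pair]
    by_cases hg : g = h
    · subst hg; simp
    · simp [hg]

/-- The coefficients `coeffAt` recover the components; surjectivity is the definition of the
extended centre as a span. -/
lemma sumMap_bijective : Function.Bijective (sumMap φ) := by
  classical
  refine ⟨fun x y hxy => DFinsupp.ext fun h => Subtype.ext ?_, fun ⟨x, hx⟩ => ?_⟩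
  · rw [← coeffAt_sumMap, ← coeffAt_sumMap, hxy]
  · suffices h : ∃ y, (sumMap φ y : A ⊗[k] MonoidAlgebra k H) = x by
      obtain ⟨y, hy⟩ := h
      exact ⟨y, Subtype.ext hy⟩
    change x ∈ Submodule.span k _ at hx
    induction hx using Submodule.span_induction with
    | mem x hx =>
      obtain ⟨a, h, ha, rfl⟩ := hx
      exact ⟨DFinsupp.single h ⟨a, ha⟩, by rw [sumMap_single]⟩
    | zero => exact ⟨0, by simp⟩
    | add x y _ _ hx hy =>
      obtain ⟨x', rfl⟩ := hx
      obtain ⟨y', rfl⟩ := hy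
      exact ⟨x' + y', by simp⟩
    | smul c x _ hx =>
      obtain ⟨x', rfl⟩ := hx
      exact ⟨c • x', by simp⟩

/-- The extended centre is the direct sum of the spaces of twisted central elements. -/
def sumEquiv : (Π₀ h, twistedCentral φ h) ≃ₗ[k] extendedCentre φ :=
  LinearEquiv.ofBijective (sumMap φ) (sumMap_bijective φ)

open Classical in
lemma sumEquiv_single (h : H) (a : twistedCentral φ h) :
    sumEquiv φ (DFinsupp.single h a) = ⟨pair k a.1 h, pair_mem a.2⟩ :=
  sumMap_single φ h a

lemma pair_one : pair k (1 : A) (1 : H) = 1 := by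
  rw [pair, map_one, Algebra.TensorProduct.one_def]

variable {φ} in
-- `multTo` is indexed by its target `Φ_l`, with elements of degree `l⁻¹`. Taking `l = h⁻¹` produces
-- this double inverse, and `dbMultTo` then agrees definitionally with `dbMult`.
lemma isTwistedCentral_inv_inv {h : H} (a : twistedCentral φ h) :
    IsTwistedCentral φ a.1 h⁻¹⁻¹ := by
  rw [inv_inv]
  exact a.2

lemma one_mem_twistedCentral : (1 : A) ∈ twistedCentral φ (1 : H) := fun b => by simp

variable {φ} in
lemma mul_mem_twistedCentral {a b : A} {h g : H} (ha : a ∈ twistedCentral φ h)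
    (hb : b ∈ twistedCentral φ g) : a * b ∈ twistedCentral φ (h * g) := fun c => by
  rw [mul_assoc, hb c, ← mul_assoc, ha, map_mul, AlgEquiv.mul_apply, mul_assoc]

variable {B : Type u₂} [Ring B] [Algebra k B] (ω : H →* (B ≃ₐ[k] B))

/-- A graded linear map between extended centres. -/
def gradedMap (L : ∀ h, twistedCentral φ h →ₗ[k] twistedCentral ω h) :
    extendedCentre φ →ₗ[k] extendedCentre ω :=
  (sumEquiv ω).toLinearMap ∘ₗ DFinsupp.mapRange.linearMap L ∘ₗ (sumEquiv φ).symm.toLinearMap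

lemma gradedMap_pair (L : ∀ h, twistedCentral φ h →ₗ[k] twistedCentral ω h) {h : H}
    (a : twistedCentral φ h) :
    gradedMap φ ω L ⟨pair k a.1 h, pair_mem a.2⟩ =
      ⟨pair k (L h a).1 h, pair_mem (L h a).2⟩ := by
  classical
  rw [← sumEquiv_single, ← sumEquiv_single]
  simp only [gradedMap, LinearMap.comp_apply, LinearEquiv.coe_coe, LinearEquiv.symm_apply_apply]
  rw [DFinsupp.mapRange.linearMap_apply, DFinsupp.mapRange_single]

lemma gradedMap_bijective (L : ∀ h, twistedCentral φ h →ₗ[k] twistedCentral ω h)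
    (hL : ∀ h, Function.Bijective (L h)) : Function.Bijective (gradedMap φ ω L) := by
  have h : Function.Bijective (DFinsupp.mapRange.linearMap L) :=
    (DFinsupp.mapRange.linearEquiv fun h => LinearEquiv.ofBijective (L h) (hL h)).bijective
  exact (sumEquiv ω).bijective.comp (h.comp (sumEquiv φ).symm.bijective)

/-- A multiplicative graded linear map between extended centres, as a morphism of algebras. -/
def gradedAlgHom (L : ∀ h, twistedCentral φ h →ₗ[k] twistedCentral ω h)
    (h1 : (L 1 ⟨1, one_mem_twistedCentral φ⟩ : B) = 1)
    (hmul : ∀ (g h : H) (a : twistedCentral φ g) (b : twistedCentral φ h),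
      (L (g * h) ⟨a.1 * b.1, mul_mem_twistedCentral a.2 b.2⟩ : B) = L g a * L h b) :
    extendedCentre φ →ₐ[k] extendedCentre ω :=
  AlgHom.ofLinearMap (gradedMap φ ω L)
    (by
      have h : (1 : extendedCentre φ) =
          ⟨pair k 1 1, pair_mem (one_mem_twistedCentral φ)⟩ :=
        Subtype.ext pair_one.symm
      rw [h]
      refine (gradedMap_pair φ ω L ⟨1, one_mem_twistedCentral φ⟩).trans (Subtype.ext ?_)
      exact (congrArg (fun b : B => pair k b (1 : H)) h1).trans pair_one)
    (by
      classical
      intro x y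
      obtain ⟨x, rfl⟩ := (sumEquiv φ).surjective x
      obtain ⟨y, rfl⟩ := (sumEquiv φ).surjective y
      induction x using DFinsupp.induction with
      | h0 => simp
      | ha g a x _ _ ihx =>
        rw [map_add, add_mul, map_add, map_add, add_mul, ihx]
        congr 1
        clear ihx
        induction y using DFinsupp.induction with
        | h0 => simp
        | ha h b y _ _ ihy =>
          rw [map_add, mul_add, map_add, map_add, mul_add, ihy]
          congr 1
          have hab : (⟨pair k a.1 g, pair_mem a.2⟩ * ⟨pair k b.1 h, pair_mem b.2⟩ :
              extendedCentre φ) =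
              ⟨pair k (a.1 * b.1) (g * h), pair_mem (mul_mem_twistedCentral a.2 b.2)⟩ :=
            Subtype.ext (by
              simp only [MulMemClass.mk_mul_mk, pair, Algebra.TensorProduct.tmul_mul_tmul, map_mul])
          rw [sumEquiv_single, sumEquiv_single, gradedMap_pair, gradedMap_pair, hab]
          refine (gradedMap_pair φ ω L
            ⟨a.1 * b.1, mul_mem_twistedCentral a.2 b.2⟩).trans (Subtype.ext ?_)
          dsimp only
          rw [hmul]
          simp only [MulMemClass.mk_mul_mk, pair, Algebra.TensorProduct.tmul_mul_tmul, map_mul])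

end Graded

/-! ### The induced maps in each degree and their bijectivity -/

section Induced

variable {k : Type uk} [Field k] {H : Type uH} [Group H]
  {A : Type u₁} [Ring A] [Algebra k A] [FiniteDimensional k A]
  {B : Type u₂} [Ring B] [Algebra k B] [FiniteDimensional k B]
  [HasDerivedCategory.{w₁} (FinMod k A)] [HasDerivedCategory.{w₂} (FinMod k B)]
  {φ : H →* (A ≃ₐ[k] A)} {ω : H →* (B ≃ₐ[k] B)}

lemma exists_induced (F : Db k A ≌ Db k B) {h : H}
    (ξ : dbTwist φ h⁻¹ ⋙ F.functor ⟶ F.functor ⋙ dbTwist ω h⁻¹) (a : twistedCentral φ h) :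
    ∃ b : twistedCentral ω h,
      (transportAlong F ξ (dbMult φ a.2)).app (single 0 (regular k B)) =
        (dbMult ω b.2).app (single 0 (regular k B)) := by
  obtain ⟨b, hb, h⟩ := exists_eq_dbMultTo ω (transportAlong F ξ (dbMult φ a.2))
  exact ⟨⟨b, by rwa [inv_inv] at hb⟩, h⟩

lemma dbMult_app_regular_injective {h : H} (a b : twistedCentral φ h)
    (H : (dbMult φ a.2).app (single 0 (regular k A)) =
      (dbMult φ b.2).app (single 0 (regular k A))) : a = b :=
  Subtype.ext (dbMultTo_app_regular_injective φ (isTwistedCentral_inv_inv a)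
    (isTwistedCentral_inv_inv b) H)

lemma dbMult_add {h : H} (a b : twistedCentral φ h) (X : Db k A) :
    (dbMult φ (a + b).2).app X = (dbMult φ a.2).app X + (dbMult φ b.2).app X :=
  dbMultTo_add φ (isTwistedCentral_inv_inv a) (isTwistedCentral_inv_inv b)
    (isTwistedCentral_inv_inv (a + b)) X

lemma dbMult_smul {h : H} (c : k) (a : twistedCentral φ h) (X : Db k A) :
    (dbMult φ (c • a).2).app X = c • (dbMult φ a.2).app X :=
  dbMultTo_smul φ c (isTwistedCentral_inv_inv a) (isTwistedCentral_inv_inv (c • a)) X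

/-- The linear map on twisted central elements induced by an equivalence `F` with a natural
transformation `F ∘ Φ_{h⁻¹} ⟶ Ω_{h⁻¹} ∘ F`. -/
def inducedMap (F : Db k A ≌ Db k B) [F.functor.Additive] [F.functor.Linear k] {h : H}
    (ξ : dbTwist φ h⁻¹ ⋙ F.functor ⟶ F.functor ⋙ dbTwist ω h⁻¹) :
    twistedCentral φ h →ₗ[k] twistedCentral ω h where
  toFun a := (exists_induced F ξ a).choose
  map_add' a b := dbMult_app_regular_injective _ _ <| by
    rw [dbMult_add, ← (exists_induced F ξ _).choose_spec, ← (exists_induced F ξ _).choose_spec,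
      ← (exists_induced F ξ _).choose_spec]
    simp only [transportAlong_app, dbMult_add, Functor.map_add, Preadditive.add_comp,
      Preadditive.comp_add]
  map_smul' c a := dbMult_app_regular_injective _ _ <| by
    rw [RingHom.id_apply, dbMult_smul, ← (exists_induced F ξ _).choose_spec,
      ← (exists_induced F ξ _).choose_spec]
    simp only [transportAlong_app, dbMult_smul, Functor.map_smul, Linear.smul_comp,
      Linear.comp_smul]

lemma inducedMap_spec (F : Db k A ≌ Db k B) [F.functor.Additive] [F.functor.Linear k] {h : H}
    (ξ : dbTwist φ h⁻¹ ⋙ F.functor ⟶ F.functor ⋙ dbTwist ω h⁻¹) (a : twistedCentral φ h) :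
    (transportAlong F ξ (dbMult φ a.2)).app (single 0 (regular k B)) =
      (dbMult ω (inducedMap F ξ a).2).app (single 0 (regular k B)) :=
  (exists_induced F ξ a).choose_spec

/-- The index `l` is kept separate from `h⁻¹` because `1` and `1⁻¹`, or `h⁻¹ * g⁻¹` and `(g * h)⁻¹`,
are equal only propositionally. -/
lemma inducedMap_eq (F : Db k A ≌ Db k B) [F.functor.Additive] [F.functor.Linear k]
    (I : Intertwining φ ω F.functor) {h l : H} (hl : l = h⁻¹) {a : A} {b : B}
    (ha : IsTwistedCentral φ a l⁻¹) (ha' : a ∈ twistedCentral φ h)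
    (hb : IsTwistedCentral ω b l⁻¹)
    (hab : (transport F I (dbMultTo φ ha)).app (single 0 (regular k B)) =
      (dbMultTo ω hb).app (single 0 (regular k B))) :
    (inducedMap F (I.ξ h⁻¹) ⟨a, ha'⟩ : B) = b := by
  subst hl
  refine dbMultTo_app_regular_injective ω (l := h⁻¹)
    (isTwistedCentral_inv_inv (inducedMap F (I.ξ h⁻¹) ⟨a, ha'⟩)) hb ?_
  exact (inducedMap_spec F (I.ξ h⁻¹) ⟨a, ha'⟩).symm.trans ((transport_app F I _ _).symm.trans hab)

lemma inducedMap_one (F : Db k A ≌ Db k B) [F.functor.Additive] [F.functor.Linear k]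
    (I : Intertwining φ ω F.functor) :
    (inducedMap F (I.ξ 1⁻¹) ⟨1, one_mem_twistedCentral φ⟩ : B) = 1 := by
  have h1 : IsTwistedCentral φ (1 : A) (1 : H)⁻¹ := fun b => by simp
  have h2 : IsTwistedCentral ω (1 : B) (1 : H)⁻¹ := fun b => by simp
  refine inducedMap_eq F I inv_one.symm h1 _ h2 ?_
  rw [← cancel_mono ((dbTwistOne ω).app _), dbMultTo_one]
  exact transport_one F I _ (dbMultTo_one φ h1) _

lemma inducedMap_mul (F : Db k A ≌ Db k B) [F.functor.Additive] [F.functor.Linear k]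
    (I : Intertwining φ ω F.functor) (g h : H) (a : twistedCentral φ g)
    (b : twistedCentral φ h) :
    (inducedMap F (I.ξ (g * h)⁻¹) ⟨a.1 * b.1, mul_mem_twistedCentral a.2 b.2⟩ : B) =
      inducedMap F (I.ξ g⁻¹) a * inducedMap F (I.ξ h⁻¹) b := by
  have e : g * h = (h⁻¹ * g⁻¹)⁻¹ := by simp
  have h1 : IsTwistedCentral φ (a.1 * b.1) (h⁻¹ * g⁻¹)⁻¹ := e ▸ mul_mem_twistedCentral a.2 b.2
  have h2 : IsTwistedCentral ω ((inducedMap F (I.ξ g⁻¹) a).1 * (inducedMap F (I.ξ h⁻¹) b).1)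
      (h⁻¹ * g⁻¹)⁻¹ := e ▸ mul_mem_twistedCentral (Subtype.property _) (Subtype.property _)
  refine inducedMap_eq F I (mul_inv_rev g h).symm h1 _ h2 ?_
  have ha := isTwistedCentral_inv_inv a
  have hb := isTwistedCentral_inv_inv b
  have ha' := isTwistedCentral_inv_inv (inducedMap F (I.ξ g⁻¹) a)
  have hb' := isTwistedCentral_inv_inv (inducedMap F (I.ξ h⁻¹) b)
  have sa : (transport F I (dbMultTo φ ha)).app (single 0 (regular k B)) =
      (dbMultTo ω ha').app (single 0 (regular k B)) :=
    (transport_app F I _ _).trans (inducedMap_spec F (I.ξ g⁻¹) a)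
  have sb : (transport F I (dbMultTo φ hb)).app (single 0 (regular k B)) =
      (dbMultTo ω hb').app (single 0 (regular k B)) :=
    (transport_app F I _ _).trans (inducedMap_spec F (I.ξ h⁻¹) b)
  rw [← dbMultTo_comp ω ha' hb' h2, ← sa, ← sb]
  exact (transport_comp F I _ _ _ (dbMultTo_comp φ ha hb h1) _).symm

lemma inducedMap_injective (F : Db k A ≌ Db k B) [F.functor.Additive] [F.functor.Linear k] {h : H}
    (ξ : dbTwist φ h⁻¹ ⋙ F.functor ≅ F.functor ⋙ dbTwist ω h⁻¹)
    (hF : ∃ (n : ℤ) (M : FinMod k B),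
      Nonempty (F.functor.obj (single 0 (regular k A)) ≅ single n M))
    (hF' : ∃ T : FinMod k A, ∀ m : ℤ, ∃ n : ℤ,
      Nonempty (F.inverse.obj (single m (regular k B)) ≅ single n T)) :
    Function.Injective (inducedMap F ξ.hom) := by
  rw [injective_iff_map_eq_zero]
  intro a ha
  have hz {X Y : Db k A} (e : X ≅ Y) (hX : (dbMult φ a.2).app X = 0) :
      (dbMult φ a.2).app Y = 0 := by
    have := (dbMult φ a.2).naturality e.hom
    rw [hX, zero_comp] at this
    exact (Preadditive.IsIso.comp_left_eq_zero e.hom _).1 this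
  obtain ⟨m, M, ⟨e⟩⟩ := hF
  obtain ⟨T, hT⟩ := hF'
  obtain ⟨n₀, ⟨e₀⟩⟩ := hT 0
  obtain ⟨n₁, ⟨e₁⟩⟩ := hT m
  have h0 : (transportAlong F ξ.hom (dbMult φ a.2)).app (single 0 (regular k B)) = 0 := by
    rw [inducedMap_spec, ha]
    simpa using dbMult_smul (φ := ω) (0 : k) (0 : twistedCentral ω h) (single 0 (regular k B))
  -- Vanishing is passed from `B` in degree `0` to `T` in degree `n₀`, to `T` in degree `n₁`, to `B`
  -- in degree `m`, to `M ≅ F(A)`, and finally to `A`.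
  have h1 := hz e₀ ((transportAlong_app_eq_zero_iff F ξ _ _).1 h0)
  have h2 := hz e₁.symm
    ((dbMultTo_app_single_eq_zero_iff φ (isTwistedCentral_inv_inv a) n₀ n₁ T).1 h1)
  have h3 := app_single_eq_zero ω _ m ((transportAlong_app_eq_zero_iff F ξ _ _).2 h2) M
  have h4 := hz (F.inverse.mapIso e.symm ≪≫ (F.unitIso.app _).symm)
    ((transportAlong_app_eq_zero_iff F ξ _ _).1 h3)
  exact Subtype.ext (eq_zero_of_dbMultTo φ (isTwistedCentral_inv_inv a) h4)

lemma exists_iso_single_of_commShift (G : Db k A ⥤ Db k B) [G.CommShift ℤ]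
    (hG : ∃ (n : ℤ) (M : FinMod k B), Nonempty (G.obj (single 0 (regular k A)) ≅ single n M)) :
    ∃ T : FinMod k B, ∀ m : ℤ, ∃ n : ℤ,
      Nonempty (G.obj (single m (regular k A)) ≅ single n T) := by
  obtain ⟨n, M, ⟨e⟩⟩ := hG
  -- Shifting by `a` lowers the degree by `a`, so the shift by `-m` takes degree `0` to `m` and
  -- degree `n` to `n + m`.
  exact ⟨M, fun m => ⟨n + m, ⟨G.mapIso (singleShiftIso 0 (-m) m (by simp) _).symm ≪≫
    (G.commShiftIso (-m)).app _ ≪≫ (shiftFunctor _ (-m)).mapIso e ≪≫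
      singleShiftIso n (-m) (n + m) (by ring) M⟩⟩⟩

lemma inducedMap_bijective (F : Db k A ≌ Db k B) [F.functor.CommShift ℤ] [F.functor.Additive]
    [F.functor.Linear k] (I : Intertwining φ ω F.functor) (hF : IsStrong F) (h : H) :
    Function.Bijective (inducedMap F (I.ξ h⁻¹)) := by
  let ξ : dbTwist φ h⁻¹ ⋙ F.functor ≅ F.functor ⋙ dbTwist ω h⁻¹ :=
    NatIso.ofComponents (fun X => asIso ((I.ξ h⁻¹).app X)) (fun f => (I.ξ h⁻¹).naturality f)
  let : F.inverse.CommShift ℤ := F.commShiftInverse ℤ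
  -- The square for `F⁻¹` is obtained from the inverse of `ξ` by inverting the horizontal
  -- equivalences.
  let ξ' : dbTwist ω h⁻¹ ⋙ F.symm.functor ≅ F.symm.functor ⋙ dbTwist φ h⁻¹ :=
    (CatCommSq.hInv F (dbTwist φ h⁻¹) (dbTwist ω h⁻¹) F ⟨ξ.symm⟩).iso.symm
  have h1 : Function.Injective (inducedMap F (I.ξ h⁻¹)) :=
    inducedMap_injective F ξ hF.1 (exists_iso_single_of_commShift F.inverse hF.2)
  have : F.symm.functor.Additive := inferInstanceAs F.inverse.Additive
  have : F.symm.functor.Linear k := inferInstanceAs (F.inverse.Linear k)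
  have h2 : Function.Injective (inducedMap F.symm ξ'.hom) :=
    inducedMap_injective F.symm ξ' hF.2 (exists_iso_single_of_commShift F.functor hF.1)
  -- The two injections need not be mutually inverse; they are only used to equate dimensions.
  have hrank := le_antisymm (LinearMap.finrank_le_finrank_of_injective h1)
    (LinearMap.finrank_le_finrank_of_injective h2)
  exact ⟨h1, (LinearMap.injective_iff_surjective_of_finrank_eq_finrank hrank).1 h1⟩

end Induced

end ExtendedCentre

end

theorem mainTheorem3 {k : Type uk} [Field k] [IsAlgClosed k] {H : Type uH} [Group H]
    {A : Type u₁} [Ring A] [Algebra k A] [FiniteDimensional k A]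
    {B : Type u₂} [Ring B] [Algebra k B] [FiniteDimensional k B]
    [HasDerivedCategory.{w₁} (ExtendedCentre.FinMod k A)]
    [HasDerivedCategory.{w₂} (ExtendedCentre.FinMod k B)]
    (φ : H →* (A ≃ₐ[k] A)) (ω : H →* (B ≃ₐ[k] B))
    (F : ExtendedCentre.Db k A ≌ ExtendedCentre.Db k B)
    [F.functor.CommShift ℤ] [F.functor.IsTriangulated] [F.functor.Linear k]
    (I : ExtendedCentre.Intertwining φ ω F.functor) :
    ∃ f : ExtendedCentre.extendedCentre φ →ₐ[k] ExtendedCentre.extendedCentre ω,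
      ExtendedCentre.IsInduced F I f ∧
      (ExtendedCentre.IsStrong F → Function.Bijective f) := by
  have : F.functor.Additive := inferInstance
  refine ⟨ExtendedCentre.gradedAlgHom φ ω (fun h => ExtendedCentre.inducedMap F (I.ξ h⁻¹))
    (ExtendedCentre.inducedMap_one F I) (ExtendedCentre.inducedMap_mul F I),
    fun a h ha => ?_, fun hF => ?_⟩
  · exact ⟨_, (ExtendedCentre.inducedMap F (I.ξ h⁻¹) ⟨a, ha⟩).2,
      ExtendedCentre.gradedMap_pair φ ω _ ⟨a, ha⟩, (ExtendedCentre.transport_app F I _ _).trans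
        (ExtendedCentre.inducedMap_spec F (I.ξ h⁻¹) ⟨a, ha⟩)⟩
  · exact ExtendedCentre.gradedMap_bijective φ ω _ (ExtendedCentre.inducedMap_bijective F I hF)
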